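/- **Theorem.** There is an absolute constant $C$ with $0<C\le 32.62$ such that the following holds. Let $d,M,N$ be natural numbers, let $T\subset\Gamma\subset\mathbb{Z}^d$ be finite sets with $|T|\le M$, put $D=|\Gamma|$, and let $$f(x)=\sum_{k\in\Gamma}c_k e^{ik\cdot x},\qquad c_k\in\mathbb{C},$$ be a nonzero trigonometric polynomial whose coefficients are supported on $T$ (i.e. $c_k=0$ for $k\notin T$). Let $\epsilon>0$ and let $x_1,\dots,x_N$ be independent random points that are either 1. (continuous model) uniformly distributed on $[0,2\pi]^d$, or 2. (discrete model) uniformly distributed on the grid $\{0,\tfrac{2\pi}{m},\dots,\tfrac{2\pi(m-1)}{m}\}^d$ for some integer $m\ge 2$ such that distinct elements of $\Gamma$ are distinct modulo $m$ (so that $\Gamma$ may be regarded as a subset of $\mathbb{Z}_m^d$). If $$N\ \ge\ C\,M\,\log(8D/\epsilon),$$ then with probability at least $1-\epsilon$ Orthogonal Matching Pursuit, applied to the samples $f(x_1),\dots,f(x_N)$ and the frequency set $\Gamma$, selects an element of $T$ in its first iteration, whichever way ties are broken. Here Orthogonal Matching Pursuit is the following algorithm. Put $\phi_k=(e^{ik\cdot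 x_1},\dots,e^{ik\cdot x_N})\in\mathbb{C}^N$, $y=(f(x_1),\dots,f(x_N))$, $r_0=y$ and $T_0=\emptyset$. In iteration $s=1,2,\dots$ choose $k_s\in\Gamma$ maximizing $|\langle r_{s-1},\phi_k\rangle|$ over $k\in\Gamma$, put $T_s=T_{s-1}\cup\{k_s\}$, choose $(a_k)_{k\in T_s}$ minimizing $\|\sum_{k\in T_s}a_k\phi_k-y\|_2$, and put $r_s=y-\sum_{k\in T_s}a_k\phi_k$. -/

import Mathlib

open MeasureTheory ProbabilityTheory

namespace SparseTrig

noncomputable section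

/-- The exponential `x ↦ e^{i k·x}` on `ℝ^d` for a frequency `k ∈ ℤ^d`. -/
def expFun {d : ℕ} (k : Fin d → ℤ) (x : Fin d → ℝ) : ℂ :=
  Complex.exp (Complex.I * ((∑ i, (k i : ℝ) * x i : ℝ) : ℂ))

/-- The trigonometric polynomial `f(x) = ∑_{k ∈ Γ} c_k e^{i k·x}`. -/
def trigPoly {d : ℕ} (Γ : Finset (Fin d → ℤ)) (c : (Fin d → ℤ) → ℂ) (x : Fin d → ℝ) : ℂ :=
  ∑ k ∈ Γ, c k * expFun k x

/-- The vector `(f(x_1), …, f(x_N))` of samples of a function `f`, with the Euclidean norm. -/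
def sampleVec {d N : ℕ} (f : (Fin d → ℝ) → ℂ) (x : Fin N → Fin d → ℝ) :
    EuclideanSpace ℂ (Fin N) :=
  WithLp.toLp 2 fun j => f (x j)

/-- The column `φ_k = (e^{i k·x_1}, …, e^{i k·x_N})` of the matrix `F_X`. -/
def col {d N : ℕ} (x : Fin N → Fin d → ℝ) (k : Fin d → ℤ) : EuclideanSpace ℂ (Fin N) :=
  sampleVec (expFun k) x

/-- The product `F_{SX} a = ∑_{k ∈ S} a_k φ_k`. -/
def synth {d N : ℕ} (x : Fin N → Fin d → ℝ) (S : Finset (Fin d → ℤ)) (a : (Fin d → ℤ) → ℂ) :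
    EuclideanSpace ℂ (Fin N) :=
  ∑ k ∈ S, a k • col x k

/-- `k`, `S`, `r` record the selected indices `k_1, …, k_n`, the index sets `S_0, …, S_n` and the
residuals `r_0, …, r_n` of `n` iterations of Orthogonal Matching Pursuit with sampling points `x`,
sampling vector `y` and frequency set `Γ`. Ties in the selection step (and among the least squares
solutions) may be broken in any way; values at indices beyond `n` are irrelevant. -/
structure IsOMPRun {d N : ℕ} (Γ : Finset (Fin d → ℤ)) (x : Fin N → Fin d → ℝ)
    (y : EuclideanSpace ℂ (Fin N)) (n : ℕ) (k : ℕ → Fin d → ℤ) (S : ℕ → Finset (Fin d → ℤ))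
    (r : ℕ → EuclideanSpace ℂ (Fin N)) : Prop where
  start_residual : r 0 = y
  start_set : S 0 = ∅
  select_mem : ∀ s < n, k (s + 1) ∈ Γ
  select_max : ∀ s < n, ∀ j ∈ Γ, ‖inner ℂ (r s) (col x j)‖ ≤ ‖inner ℂ (r s) (col x (k (s + 1)))‖
  augment : ∀ s < n, S (s + 1) = insert (k (s + 1)) (S s)
  project : ∀ s < n, ∃ a : (Fin d → ℤ) → ℂ,
    (∀ b : (Fin d → ℤ) → ℂ, ‖synth x (S (s + 1)) a - y‖ ≤ ‖synth x (S (s + 1)) b - y‖) ∧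
      r (s + 1) = y - synth x (S (s + 1)) a

/-- The cube `[0, 2π]^d`. -/
def cube (d : ℕ) : Set (Fin d → ℝ) := {x | ∀ i, x i ∈ Set.Icc 0 (2 * Real.pi)}

/-- The grid `{0, 2π/m, …, 2π(m-1)/m}^d`. -/
def grid (d m : ℕ) : Set (Fin d → ℝ) :=
  {x | ∀ i, ∃ a : ℕ, a < m ∧ x i = 2 * Real.pi * a / m}

/-- The sampling points are independent and uniformly distributed on `[0, 2π]^d`. -/
structure IsContinuousModel {Ω : Type*} [MeasurableSpace Ω] (μ : Measure Ω) {d N : ℕ}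
    (X : Fin N → Ω → Fin d → ℝ) : Prop where
  measurable : ∀ j, Measurable (X j)
  indep : iIndepFun X μ
  uniform : ∀ j, μ.map (X j) = cond volume (cube d)

/-- The sampling points are independent and uniformly distributed on the grid
`{0, 2π/m, …, 2π(m-1)/m}^d`. -/
structure IsDiscreteModel {Ω : Type*} [MeasurableSpace Ω] (μ : Measure Ω) {d N : ℕ} (m : ℕ)
    (X : Fin N → Ω → Fin d → ℝ) : Prop where
  measurable : ∀ j, Measurable (X j)
  indep : iIndepFun X μ
  uniform : ∀ j, μ.map (X j) = uniformOn (grid d m)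

/-- `Γ ⊂ ℤ^d` is identified with a subset of `ℤ_m^d`: distinct frequencies in `Γ` stay distinct
modulo `m`. This holds in particular if `Γ ⊆ {0, …, m-1}^d`. -/
def EmbedsMod {d : ℕ} (m : ℕ) (Γ : Finset (Fin d → ℤ)) : Prop :=
  Set.InjOn (fun (k : Fin d → ℤ) (i : Fin d) => (k i : ZMod m)) (Γ : Set (Fin d → ℤ))

end

end SparseTrig

namespace SparseTrig

/-! ### A Bernstein type tail bound -/

/-! Let `A` be the sum of `‖c k‖ ^ 2`, so that `f` has mean square `A` under the sampling law. The
sampled energy `∑ j, ‖f (x j)‖ ^ 2` is a combination of the correlations `⟨y, φ_k⟩`, `k ∈ T`, with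
coefficients `c k`. If a frequency outside `T` wins with correlation `b`, this energy is at most
`‖c‖₁ * b ≤ √(M * A) * b` (`sum_norm_sq_le_of_forall_inner_le`). So the selection is right as soon
as the energy exceeds `N * A / 2` and every off-support correlation is below `N * √(A / (4 * M))`
(`mem_of_isOMPRun`).

Both are statements about sums of i.i.d. bounded variables. The models enter only through
orthonormality of the exponentials, which gives the energy mean `N * A`, the off-support
correlations mean zero, and both a controlled variance. The tail bound `measureReal_sum_ge_le` makes
each bad event have probability at most `exp (-N / (32 * M))`, and a union bound over at most `1 + 4
* D ≤ 8 * D` events yields `C = 32`. -/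

theorem exp_le_one_add_add_sq {x : ℝ} (hx : |x| ≤ 1) : Real.exp x ≤ 1 + x + x ^ 2 := by
  have := (abs_le.1 (Real.abs_exp_sub_one_sub_id_le hx)).2
  linarith

theorem integrable_of_abs_le {E : Type*} [MeasurableSpace E] {ν : Measure E} [IsFiniteMeasure ν]
    {g : E → ℝ} (hg : Measurable g) {K : ℝ} (hK : ∀ x, |g x| ≤ K) : Integrable g ν :=
  Integrable.of_bound hg.aestronglyMeasurable K (ae_of_all _ hK)

theorem integral_exp_mul_le {E : Type*} [MeasurableSpace E] (ν : Measure E)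
    [IsProbabilityMeasure ν] {g : E → ℝ} (hg : Measurable g) {K V t : ℝ} (hK : ∀ x, |g x| ≤ K)
    (h0 : ∫ x, g x ∂ν = 0) (hV : ∫ x, g x ^ 2 ∂ν ≤ V) (ht : 0 ≤ t) (htK : t * K ≤ 1) :
    ∫ x, Real.exp (t * g x) ∂ν ≤ Real.exp (t ^ 2 * V) := by
  have hbd : ∀ x, |t * g x| ≤ 1 := fun x => by
    rw [abs_mul, abs_of_nonneg ht]
    exact (mul_le_mul_of_nonneg_left (hK x) ht).trans htK
  have hi : Integrable g ν := integrable_of_abs_le hg hK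
  have hi2 : Integrable (fun x => g x ^ 2) ν :=
    integrable_of_abs_le (hg.pow_const 2) (K := K ^ 2) fun x => by
      rw [abs_pow]
      exact pow_le_pow_left₀ (abs_nonneg _) (hK x) 2
  have hie : Integrable (fun x => Real.exp (t * g x)) ν :=
    integrable_of_abs_le (by fun_prop) (K := Real.exp 1) fun x => by
      rw [Real.abs_exp]
      exact Real.exp_le_exp.2 ((le_abs_self _).trans (hbd x))
  have hlin : Integrable (fun x => 1 + t * g x) ν := (integrable_const 1).add (hi.const_mul t)
  calc ∫ x, Real.exp (t * g x) ∂ν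
      ≤ ∫ x, (1 + t * g x + t ^ 2 * g x ^ 2) ∂ν := by
        refine integral_mono hie (hlin.add (hi2.const_mul (t ^ 2))) fun x => ?_
        have := exp_le_one_add_add_sq (hbd x)
        rwa [mul_pow] at this
    _ = 1 + t ^ 2 * ∫ x, g x ^ 2 ∂ν := by
        rw [integral_add hlin (hi2.const_mul (t ^ 2)),
          integral_add (integrable_const 1) (hi.const_mul t), integral_const_mul,
          integral_const_mul, h0]
        simp
    _ ≤ 1 + t ^ 2 * V := by gcongr
    _ ≤ Real.exp (t ^ 2 * V) := by
        have := Real.add_one_le_exp (t ^ 2 * V)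
        linarith

/-- Chernoff's method with the quadratic bound on the exponential; `huK` keeps the exponent in the
range where that bound holds. -/
theorem measureReal_sum_ge_le {Ω E : Type*} [MeasurableSpace Ω] [MeasurableSpace E]
    {μ : Measure Ω} [IsProbabilityMeasure μ] {ν : Measure E} {N : ℕ} {X : Fin N → Ω → E}
    (hX : ∀ j, Measurable (X j)) (hind : iIndepFun X μ) (hν : ∀ j, μ.map (X j) = ν)
    {g : E → ℝ} (hg : Measurable g) {K V u : ℝ} (hK : ∀ x, |g x| ≤ K)
    (h0 : ∫ x, g x ∂ν = 0) (hV : ∫ x, g x ^ 2 ∂ν ≤ V) (hVpos : 0 < V) (hu : 0 ≤ u)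
    (huK : u * K ≤ 2 * V) :
    μ.real {ω | N * u ≤ ∑ j, g (X j ω)} ≤ Real.exp (-(N * (u ^ 2 / (4 * V)))) := by
  -- This value minimises the exponent `t ^ 2 * V - t * u`.
  set t : ℝ := u / (2 * V) with ht
  have ht0 : 0 ≤ t := by positivity
  have htK : t * K ≤ 1 := by
    rw [ht, div_mul_eq_mul_div, div_le_one (by positivity)]
    exact huK
  set Y : Fin N → Ω → ℝ := fun j ω => g (X j ω) with hY
  have hYm : ∀ j, Measurable (Y j) := fun j => hg.comp (hX j)
  have hYind : iIndepFun Y μ := hind.comp (fun _ => g) fun _ => hg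
  have hmgf : ∀ j, mgf (Y j) μ t ≤ Real.exp (t ^ 2 * V) := fun j => by
    have hprob : IsProbabilityMeasure ν := hν j ▸
      Measure.isProbabilityMeasure_map (hX j).aemeasurable
    have := integral_exp_mul_le ν hg hK h0 hV ht0 htK
    rw [← hν j, integral_map (hX j).aemeasurable
      (by exact (Measurable.exp (hg.const_mul t)).aestronglyMeasurable)] at this
    exact this
  have hint : Integrable (fun ω => Real.exp (t * (∑ j, Y j) ω)) μ := by
    simp only [Finset.sum_apply]
    refine integrable_of_abs_le
      (Measurable.exp ((Finset.measurable_sum _ fun j _ => hYm j).const_mul t))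
      (K := Real.exp (t * (N * K))) fun ω => ?_
    rw [Real.abs_exp]
    refine Real.exp_le_exp.2 (mul_le_mul_of_nonneg_left ?_ ht0)
    calc ∑ j, Y j ω ≤ ∑ _j : Fin N, K :=
          Finset.sum_le_sum fun j _ => (le_abs_self _).trans (hK _)
      _ = N * K := by simp
  have hch := measure_ge_le_exp_mul_mgf (μ := μ) (X := ∑ j, Y j) (N * u) ht0 hint
  rw [hYind.mgf_sum hYm] at hch
  have hset : {ω | (N : ℝ) * u ≤ (∑ j, Y j) ω} = {ω | (N : ℝ) * u ≤ ∑ j, g (X j ω)} := by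
    ext ω
    simp [hY, Finset.sum_apply]
  rw [hset] at hch
  calc _ ≤ Real.exp (-t * (N * u)) * ∏ j, mgf (Y j) μ t := hch
    _ ≤ Real.exp (-t * (N * u)) * ∏ _j : Fin N, Real.exp (t ^ 2 * V) := by
        gcongr with j
        · exact fun _ _ => mgf_nonneg
        · exact hmgf j
    _ = Real.exp (-(N * (u ^ 2 / (4 * V)))) := by
        rw [Finset.prod_const, ← Real.exp_nat_mul, ← Real.exp_add, Finset.card_univ,
          Fintype.card_fin, ht]
        congr 1
        field_simp
        ring

/-! ### Exponentials and trigonometric polynomials -/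

variable {d : ℕ}

theorem expFun_eq_prod (k : Fin d → ℤ) (x : Fin d → ℝ) :
    expFun k x = ∏ i, Complex.exp (Complex.I * (k i * x i)) := by
  rw [expFun, ← Complex.exp_sum]
  push_cast
  rw [Finset.mul_sum]

theorem norm_expFun (k : Fin d → ℤ) (x : Fin d → ℝ) : ‖expFun k x‖ = 1 := by
  rw [expFun, mul_comm, Complex.norm_exp_ofReal_mul_I]

theorem conj_expFun_mul_expFun (k j : Fin d → ℤ) (x : Fin d → ℝ) :
    starRingEnd ℂ (expFun k x) * expFun j x = expFun (j - k) x := by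
  simp only [expFun]
  rw [← Complex.exp_conj, ← Complex.exp_add, map_mul, Complex.conj_I, Complex.conj_ofReal]
  congr 1
  simp only [Pi.sub_apply, Int.cast_sub, sub_mul, Finset.sum_sub_distrib]
  push_cast
  ring

theorem continuous_expFun (k : Fin d → ℤ) : Continuous (expFun k) := by
  unfold expFun
  fun_prop

theorem continuous_trigPoly (Γ : Finset (Fin d → ℤ)) (c : (Fin d → ℤ) → ℂ) :
    Continuous (trigPoly Γ c) := by
  unfold trigPoly
  exact continuous_finsetSum _ fun k _ => continuous_const.mul (continuous_expFun k)

theorem trigPoly_of_subset {Γ T : Finset (Fin d → ℤ)} {c : (Fin d → ℤ) → ℂ} (hT : T ⊆ Γ)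
    (hc : ∀ k, k ∉ T → c k = 0) : trigPoly Γ c = trigPoly T c := by
  funext x
  exact (Finset.sum_subset hT fun k _ hk => by rw [hc k hk, zero_mul]).symm

theorem sum_norm_sq_le (T : Finset (Fin d → ℤ)) (c : (Fin d → ℤ) → ℂ) :
    (∑ k ∈ T, ‖c k‖) ^ 2 ≤ T.card * ∑ k ∈ T, ‖c k‖ ^ 2 :=
  sq_sum_le_card_mul_sum_sq

theorem norm_trigPoly_le (T : Finset (Fin d → ℤ)) (c : (Fin d → ℤ) → ℂ) (x : Fin d → ℝ) :
    ‖trigPoly T c x‖ ≤ ∑ k ∈ T, ‖c k‖ := by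
  refine (norm_sum_le _ _).trans_eq (Finset.sum_congr rfl fun k _ => ?_)
  rw [norm_mul, norm_expFun, mul_one]

/-- The exponentials with frequencies in `Γ` are orthonormal in `L²(ν)`. -/
def IsOrthonormalFor (ν : Measure (Fin d → ℝ)) (Γ : Finset (Fin d → ℤ)) : Prop :=
  ∀ k ∈ Γ, ∀ j ∈ Γ, k ≠ j → ∫ x, expFun (j - k) x ∂ν = 0

theorem integrable_of_norm_le {E : Type*} [MeasurableSpace E] [TopologicalSpace E]
    [OpensMeasurableSpace E] {ν : Measure E} [IsFiniteMeasure ν] {g : E → ℂ} (hg : Continuous g)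
    {K : ℝ} (hK : ∀ x, ‖g x‖ ≤ K) : Integrable g ν :=
  Integrable.of_bound hg.measurable.aestronglyMeasurable K (ae_of_all _ hK)

theorem integrable_expFun {ν : Measure (Fin d → ℝ)} [IsFiniteMeasure ν] (k : Fin d → ℤ) :
    Integrable (expFun k) ν :=
  integrable_of_norm_le (continuous_expFun k) fun x => (norm_expFun k x).le

theorem conj_trigPoly_mul_expFun (T : Finset (Fin d → ℤ)) (c : (Fin d → ℤ) → ℂ)
    (j : Fin d → ℤ) (x : Fin d → ℝ) :
    starRingEnd ℂ (trigPoly T c x) * expFun j x =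
      ∑ k ∈ T, starRingEnd ℂ (c k) * expFun (j - k) x := by
  rw [trigPoly, map_sum, Finset.sum_mul]
  refine Finset.sum_congr rfl fun k _ => ?_
  rw [map_mul, mul_assoc, conj_expFun_mul_expFun]

/-! ### Moments of a sparse trigonometric polynomial under an orthonormal sampling law -/

section Moments

variable {ν : Measure (Fin d → ℝ)} [IsProbabilityMeasure ν] {Γ T : Finset (Fin d → ℤ)}

theorem integral_conj_trigPoly_mul_expFun (hν : IsOrthonormalFor ν Γ) (hT : T ⊆ Γ)
    (c : (Fin d → ℤ) → ℂ) (hc : ∀ k, k ∉ T → c k = 0) {j : Fin d → ℤ} (hj : j ∈ Γ) :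
    ∫ x, starRingEnd ℂ (trigPoly T c x) * expFun j x ∂ν = starRingEnd ℂ (c j) := by
  simp_rw [conj_trigPoly_mul_expFun]
  rw [integral_finsetSum _ fun k _ => (integrable_expFun (j - k)).const_mul _]
  simp_rw [integral_const_mul]
  rw [Finset.sum_eq_single j]
  · simp [expFun]
  · intro k hk hkj
    rw [hν k (hT hk) j hj hkj, mul_zero]
  · intro hjT
    rw [hc j hjT, map_zero, zero_mul]

theorem integrable_conj_trigPoly_mul_expFun (c : (Fin d → ℤ) → ℂ) (j : Fin d → ℤ) :
    Integrable (fun x => starRingEnd ℂ (trigPoly T c x) * expFun j x) ν :=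
  integrable_of_norm_le ((Complex.continuous_conj.comp (continuous_trigPoly T c)).mul
    (continuous_expFun j)) (K := ∑ k ∈ T, ‖c k‖) fun x => by
      rw [norm_mul, norm_expFun, mul_one, RCLike.norm_conj]
      exact norm_trigPoly_le T c x

theorem integral_norm_trigPoly_sq (hν : IsOrthonormalFor ν Γ) (hT : T ⊆ Γ)
    (c : (Fin d → ℤ) → ℂ) (hc : ∀ k, k ∉ T → c k = 0) :
    ∫ x, ‖trigPoly T c x‖ ^ 2 ∂ν = ∑ k ∈ T, ‖c k‖ ^ 2 := by
  have h : ∀ x, ((‖trigPoly T c x‖ ^ 2 : ℝ) : ℂ) =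
      ∑ k ∈ T, c k * (starRingEnd ℂ (trigPoly T c x) * expFun k x) := fun x => by
    have := Complex.conj_mul' (trigPoly T c x)
    push_cast
    rw [← this]
    nth_rw 2 [trigPoly]
    rw [Finset.mul_sum]
    exact Finset.sum_congr rfl fun k _ => by ring
  have : ((∫ x, ‖trigPoly T c x‖ ^ 2 ∂ν : ℝ) : ℂ) = ((∑ k ∈ T, ‖c k‖ ^ 2 : ℝ) : ℂ) := by
    rw [← integral_complex_ofReal]
    simp_rw [h]
    rw [integral_finsetSum _ fun k _ =>
      (integrable_conj_trigPoly_mul_expFun c k).const_mul _]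
    push_cast
    refine Finset.sum_congr rfl fun k hk => ?_
    rw [integral_const_mul, integral_conj_trigPoly_mul_expFun hν hT c hc (hT hk),
      Complex.mul_conj']
  exact_mod_cast this

end Moments

/-! ### The two sampling models -/

theorem integral_exp_int_mul {n : ℤ} (hn : n ≠ 0) :
    ∫ t in Set.Icc 0 (2 * Real.pi), Complex.exp (Complex.I * (n * t)) = 0 := by
  rw [integral_Icc_eq_integral_Ioc, ← intervalIntegral.integral_of_le (by positivity)]
  have hn' : Complex.I * n ≠ 0 := mul_ne_zero Complex.I_ne_zero (by exact_mod_cast hn)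
  simp_rw [← mul_assoc]
  rw [integral_exp_mul_complex hn']
  have : Complex.exp (Complex.I * n * ((2 * Real.pi : ℝ) : ℂ)) = 1 := by
    rw [Complex.exp_eq_one_iff]
    exact ⟨n, by push_cast; ring⟩
  rw [this]
  simp

theorem cube_eq_pi (d : ℕ) : cube d = Set.univ.pi fun _ => Set.Icc 0 (2 * Real.pi) := by
  ext x
  simp only [cube, Set.mem_ofPred_eq, Set.mem_univ_pi]

theorem isProbabilityMeasure_cube (d : ℕ) :
    IsProbabilityMeasure (cond (volume : Measure (Fin d → ℝ)) (cube d)) := by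
  have h : (volume : Measure (Fin d → ℝ)) (cube d) = ∏ _i : Fin d, ENNReal.ofReal (2 * Real.pi) := by
    rw [cube_eq_pi, volume_pi_pi]
    simp
  refine cond_isProbabilityMeasure_of_finite ?_ ?_
  · rw [h]
    exact Finset.prod_ne_zero_iff.2 fun i _ => by simp [Real.pi_pos]
  · rw [h]
    exact ENNReal.prod_ne_top fun i _ => ENNReal.ofReal_ne_top

/-- By Fubini the integral factors over coordinates, and a coordinate where the frequencies differ
contributes zero. -/
theorem isOrthonormalFor_cube (Γ : Finset (Fin d → ℤ)) :
    IsOrthonormalFor (cond volume (cube d)) Γ := by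
  intro k _ j _ hkj
  obtain ⟨i, hi⟩ := Function.ne_iff.1 hkj.symm
  rw [ProbabilityTheory.cond, integral_smul_measure, cube_eq_pi, volume_pi,
    Measure.restrict_pi_pi]
  simp_rw [expFun_eq_prod]
  rw [integral_fintype_prod_eq_prod
    (fun i (t : ℝ) => Complex.exp (Complex.I * (((j - k) i : ℤ) * t))),
    Finset.prod_eq_zero (Finset.mem_univ i), smul_zero]
  exact integral_exp_int_mul (sub_ne_zero.2 hi)

/-- The grid `{0, 2π/m, …, 2π(m-1)/m}^d` as a finite set. -/
noncomputable def gridFinset (d m : ℕ) : Finset (Fin d → ℝ) :=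
  Fintype.piFinset fun _ => (Finset.range m).image fun a : ℕ => 2 * Real.pi * a / m

theorem coe_gridFinset (d m : ℕ) : (gridFinset d m : Set (Fin d → ℝ)) = grid d m := by
  ext x
  simp [gridFinset, grid, eq_comm]

theorem isProbabilityMeasure_grid (d : ℕ) {m : ℕ} (hm : m ≠ 0) :
    IsProbabilityMeasure (uniformOn (grid d m)) := by
  refine isProbabilityMeasure_uniformOn ?_ ?_
  · rw [← coe_gridFinset]
    exact (gridFinset d m).finite_toSet
  · exact ⟨fun _ => 0, fun _ => ⟨0, Nat.pos_of_ne_zero hm, by simp⟩⟩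

/-- A full geometric sum of powers of an `m`-th root of unity other than `1`. -/
theorem sum_exp_grid_eq_zero {m : ℕ} (hm : m ≠ 0) {n : ℤ} (hn : (n : ZMod m) ≠ 0) :
    ∑ t ∈ (Finset.range m).image (fun a : ℕ => 2 * Real.pi * a / m),
      Complex.exp (Complex.I * (n * t)) = 0 := by
  have hm' : (m : ℝ) ≠ 0 := by exact_mod_cast hm
  have hmC : (m : ℂ) ≠ 0 := by exact_mod_cast hm
  rw [Finset.sum_image fun a _ b _ hab => by
    have hpi := Real.pi_ne_zero
    field_simp at hab
    exact_mod_cast hab]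
  set z : ℂ := Complex.exp (2 * Real.pi * Complex.I * (n / m)) with hz
  have hzpow : z ^ m = 1 := by
    rw [hz, ← Complex.exp_nat_mul, Complex.exp_eq_one_iff]
    exact ⟨n, by field_simp⟩
  have hz1 : z ≠ 1 := by
    intro h
    rw [hz, Complex.exp_eq_one_iff] at h
    obtain ⟨q, hq⟩ := h
    have hpi : (Real.pi : ℂ) ≠ 0 := by exact_mod_cast Real.pi_ne_zero
    have hq' : (n : ℂ) = m * q := by
      have h2 : (2 * Real.pi * Complex.I : ℂ) ≠ 0 := Complex.two_pi_I_ne_zero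
      have h3 : (n / m : ℂ) = q := mul_left_cancel₀ h2 (by rw [hq]; ring)
      rw [← h3]
      field_simp
    have hq'' : n = m * q := by exact_mod_cast hq'
    exact hn (by rw [hq'']; simp)
  have hterm : ∀ a ∈ Finset.range m,
      Complex.exp (Complex.I * (n * ((2 * Real.pi * a / m : ℝ) : ℂ))) = z ^ a := fun a _ => by
    rw [hz, ← Complex.exp_nat_mul]
    congr 1
    push_cast
    ring
  rw [Finset.sum_congr rfl hterm, geom_sum_eq hz1, hzpow, sub_self, zero_div]

theorem isOrthonormalFor_grid {Γ : Finset (Fin d → ℤ)} {m : ℕ} (hm : m ≠ 0)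
    (hΓ : EmbedsMod m Γ) : IsOrthonormalFor (uniformOn (grid d m)) Γ := by
  intro k hk j hj hkj
  obtain ⟨i, hi⟩ := Function.ne_iff.1 fun h => hkj (hΓ hk hj h)
  rw [uniformOn, ProbabilityTheory.cond, integral_smul_measure, ← coe_gridFinset]
  have hfin : IsFiniteMeasure (Measure.count.restrict (gridFinset d m : Set (Fin d → ℝ))) :=
    ⟨by
      rw [Measure.restrict_apply_univ, Measure.count_apply_finset]
      exact ENNReal.natCast_lt_top _⟩
  rw [setIntegral_finset _ (integrable_expFun (j - k))]
  simp only [measureReal_def, Measure.count_singleton, ENNReal.toReal_one, one_smul]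
  simp_rw [expFun_eq_prod]
  rw [gridFinset, ← Finset.prod_univ_sum (fun _ => (Finset.range m).image
      fun a : ℕ => 2 * Real.pi * a / m)
    (fun i (t : ℝ) => Complex.exp (Complex.I * (((j - k) i : ℤ) * t))),
    Finset.prod_eq_zero (Finset.mem_univ i), smul_zero]
  refine sum_exp_grid_eq_zero hm ?_
  rw [Pi.sub_apply, Int.cast_sub]
  exact sub_ne_zero.2 (Ne.symm hi)

/-! ### Correlations of the sample vector with the columns -/

theorem inner_sampleVec_col {N : ℕ} (f : (Fin d → ℝ) → ℂ) (x : Fin N → Fin d → ℝ)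
    (k : Fin d → ℤ) :
    inner ℂ (sampleVec f x) (col x k) = ∑ j, starRingEnd ℂ (f (x j)) * expFun k (x j) := by
  simp [PiLp.inner_apply, col, sampleVec, mul_comm]

/-- Expanding one factor of `⟨y, y⟩` in the columns turns the energy into `∑ c k * ⟨y, φ_k⟩`. -/
theorem sum_norm_sq_le_of_forall_inner_le {N : ℕ} (T : Finset (Fin d → ℤ))
    (c : (Fin d → ℤ) → ℂ) (x : Fin N → Fin d → ℝ) {B : ℝ}
    (hB : ∀ k ∈ T, ‖inner ℂ (sampleVec (trigPoly T c) x) (col x k)‖ ≤ B) :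
    ∑ j, ‖trigPoly T c (x j)‖ ^ 2 ≤ (∑ k ∈ T, ‖c k‖) * B := by
  have h : ((∑ j, ‖trigPoly T c (x j)‖ ^ 2 : ℝ) : ℂ) =
      ∑ k ∈ T, c k * inner ℂ (sampleVec (trigPoly T c) x) (col x k) := by
    simp_rw [inner_sampleVec_col, Finset.mul_sum]
    rw [Finset.sum_comm]
    push_cast
    refine Finset.sum_congr rfl fun j _ => ?_
    rw [← Complex.conj_mul']
    nth_rw 2 [trigPoly]
    rw [Finset.mul_sum]
    exact Finset.sum_congr rfl fun k _ => by ring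
  calc ∑ j, ‖trigPoly T c (x j)‖ ^ 2
      = ‖((∑ j, ‖trigPoly T c (x j)‖ ^ 2 : ℝ) : ℂ)‖ := by
        rw [Complex.norm_real, Real.norm_of_nonneg (by positivity)]
    _ ≤ ∑ k ∈ T, ‖c k‖ * B := by
        rw [h]
        refine (norm_sum_le _ _).trans (Finset.sum_le_sum fun k hk => ?_)
        rw [norm_mul]
        exact mul_le_mul_of_nonneg_left (hB k hk) (norm_nonneg _)
    _ = (∑ k ∈ T, ‖c k‖) * B := (Finset.sum_mul _ _ _).symm

/-- The four directions `1, -1, i, -i` in the complex plane. -/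
noncomputable def axisDirections : Finset ℂ := {1, -1, Complex.I, -Complex.I}

theorem card_axisDirections_le : axisDirections.card ≤ 4 := Finset.card_le_four

theorem norm_of_mem_axisDirections {w : ℂ} (hw : w ∈ axisDirections) : ‖w‖ = 1 := by
  simp only [axisDirections, Finset.mem_insert, Finset.mem_singleton] at hw
  rcases hw with rfl | rfl | rfl | rfl <;> simp

/-- Reduces a complex tail bound to four real ones, at the cost of a factor `√2`. -/
theorem norm_sq_lt_of_axisDirections {z : ℂ} {s : ℝ}
    (h : ∀ w ∈ axisDirections, (w * z).re < s) : ‖z‖ ^ 2 < 2 * s ^ 2 := by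
  have h1 := h 1 (by simp [axisDirections])
  have h2 := h (-1) (by simp [axisDirections])
  have h3 := h Complex.I (by simp [axisDirections])
  have h4 := h (-Complex.I) (by simp [axisDirections])
  simp at h1 h2 h3 h4
  have hre : z.re ^ 2 < s ^ 2 := sq_lt_sq' (by linarith) h1
  have him : z.im ^ 2 < s ^ 2 := sq_lt_sq' (by linarith) (by linarith)
  rw [Complex.sq_norm, Complex.normSq_apply]
  nlinarith

theorem mem_of_isOMPRun {N M : ℕ} {Γ T : Finset (Fin d → ℤ)} {c : (Fin d → ℤ) → ℂ}
    (hT : T ⊆ Γ) (hM : T.card ≤ M) (hM0 : 0 < M) {A : ℝ} (hA : A = ∑ k ∈ T, ‖c k‖ ^ 2)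
    (hA0 : 0 < A) (x : Fin N → Fin d → ℝ)
    (h1 : ∑ j, (A - ‖trigPoly T c (x j)‖ ^ 2) < N * (A / 2))
    (h2 : ∀ k ∈ Γ \ T, ∀ w ∈ axisDirections,
      ∑ j, (w * (starRingEnd ℂ (trigPoly T c (x j)) * expFun k (x j))).re < N * √(A / (8 * M)))
    {n : ℕ} {k : ℕ → Fin d → ℤ} {S : ℕ → Finset (Fin d → ℤ)}
    {r : ℕ → EuclideanSpace ℂ (Fin N)} (hn : 1 ≤ n)
    (hrun : IsOMPRun Γ x (sampleVec (trigPoly T c) x) n k S r) : k 1 ∈ T := by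
  by_contra hk
  have hk1 : k 1 ∈ Γ := hrun.select_mem 0 hn
  have hmax := hrun.select_max 0 hn
  rw [hrun.start_residual, zero_add] at hmax
  set b := ‖inner ℂ (sampleVec (trigPoly T c) x) (col x (k 1))‖ with hb
  have hMr : (0 : ℝ) < M := by exact_mod_cast hM0
  have hbsq : b ^ 2 < 2 * (N * √(A / (8 * M))) ^ 2 := by
    rw [hb, inner_sampleVec_col]
    refine norm_sq_lt_of_axisDirections fun w hw => ?_
    rw [Finset.mul_sum, Complex.re_sum]
    exact h2 _ (Finset.mem_sdiff.2 ⟨hk1, hk⟩) w hw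
  rw [mul_pow, Real.sq_sqrt (by positivity)] at hbsq
  have hle := sum_norm_sq_le_of_forall_inner_le T c x fun j hj => hmax j (hT hj)
  have hlow : N * (A / 2) < ∑ j, ‖trigPoly T c (x j)‖ ^ 2 := by
    rw [Finset.sum_sub_distrib] at h1
    simp at h1
    linarith
  have hl1 : (∑ k ∈ T, ‖c k‖) ^ 2 ≤ M * A := by
    refine (sum_norm_sq_le T c).trans ?_
    rw [← hA]
    gcongr
  -- The thresholds are matched so that the upper bound for this square equals its lower bound;
  -- strictness comes from `h1`.
  have h3 : (N * (A / 2)) ^ 2 < ((∑ k ∈ T, ‖c k‖) * b) ^ 2 :=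
    pow_lt_pow_left₀ (hlow.trans_le hle) (by positivity) two_ne_zero
  have h4 : ((∑ k ∈ T, ‖c k‖) * b) ^ 2 ≤ M * A * (2 * (N ^ 2 * (A / (8 * M)))) := by
    rw [mul_pow]
    gcongr
  have h5 : (M : ℝ) * A * (2 * (N ^ 2 * (A / (8 * M)))) = (N * (A / 2)) ^ 2 := by
    field_simp
    ring
  linarith

/-! ### Probability of the bad events and the union bound -/

theorem measureReal_forall_isOMPRun_ge {N M : ℕ} {Γ T : Finset (Fin d → ℤ)}
    {c : (Fin d → ℤ) → ℂ} {ε : ℝ} {Ω : Type*} [MeasurableSpace Ω] {μ : Measure Ω}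
    [IsProbabilityMeasure μ] {X : Fin N → Ω → Fin d → ℝ} {ν : Measure (Fin d → ℝ)}
    [IsProbabilityMeasure ν] (hν : IsOrthonormalFor ν Γ) (hX : ∀ j, Measurable (X j))
    (hind : iIndepFun X μ) (hmap : ∀ j, μ.map (X j) = ν)
    (hT : T ⊆ Γ) (hM : T.card ≤ M) (hc : ∀ k, k ∉ T → c k = 0) (hc0 : c ≠ 0) (hε : 0 < ε)
    (hN : 32 * M * Real.log (8 * Γ.card / ε) ≤ N) :
    1 - ε ≤ μ.real {ω | ∀ (n : ℕ) (k : ℕ → Fin d → ℤ) (S : ℕ → Finset (Fin d → ℤ))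
      (r : ℕ → EuclideanSpace ℂ (Fin N)), 1 ≤ n →
      IsOMPRun Γ (fun j => X j ω) (sampleVec (trigPoly Γ c) (fun j => X j ω)) n k S r →
      k 1 ∈ T} := by
  rw [trigPoly_of_subset hT hc]
  obtain ⟨k₀, hk₀⟩ := Function.ne_iff.1 hc0
  have hk₀T : k₀ ∈ T := by
    by_contra h
    exact hk₀ (hc k₀ h)
  have hT0 : 0 < T.card := Finset.card_pos.2 ⟨k₀, hk₀T⟩
  have hM0 : 0 < M := hT0.trans_le hM
  have hMr : (0 : ℝ) < M := by exact_mod_cast hM0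
  have hM1 : (1 : ℝ) ≤ M := by exact_mod_cast hM0
  have hΓ0 : (0 : ℝ) < Γ.card := by exact_mod_cast hT0.trans_le (Finset.card_le_card hT)
  set A : ℝ := ∑ k ∈ T, ‖c k‖ ^ 2 with hA
  have hA0 : 0 < A :=
    Finset.sum_pos' (fun _ _ => by positivity) ⟨k₀, hk₀T, by
      have : 0 < ‖c k₀‖ := norm_pos_iff.2 hk₀
      positivity⟩
  have hbound : ∀ x, ‖trigPoly T c x‖ ^ 2 ≤ M * A := fun x => by
    refine (pow_le_pow_left₀ (norm_nonneg _) (norm_trigPoly_le T c x) 2).trans ?_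
    refine (sum_norm_sq_le T c).trans ?_
    rw [← hA]
    gcongr
  have hmean := integral_norm_trigPoly_sq hν hT c hc
  rw [← hA] at hmean
  have hcont := continuous_trigPoly T c
  have hint2 : Integrable (fun x => ‖trigPoly T c x‖ ^ 2) ν :=
    integrable_of_abs_le (by exact (hcont.norm.pow 2).measurable) (K := M * A) fun x => by
      rw [abs_of_nonneg (by positivity)]
      exact hbound x
  set q : ℝ := Real.exp (-(N * (1 / (32 * M)))) with hq
  set E₀ : Set Ω := {ω | N * (A / 2) ≤ ∑ j, (A - ‖trigPoly T c (X j ω)‖ ^ 2)} with hE₀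
  set E : (Fin d → ℤ) × ℂ → Set Ω := fun p => {ω | N * √(A / (8 * M)) ≤
    ∑ j, (p.2 * (starRingEnd ℂ (trigPoly T c (X j ω)) * expFun p.1 (X j ω))).re} with hE
  have hE₀q : μ.real E₀ ≤ q := by
    have h := measureReal_sum_ge_le (V := M * A ^ 2) (K := M * A) (u := A / 2) hX hind hmap
      (g := fun x => A - ‖trigPoly T c x‖ ^ 2)
      (by exact (continuous_const.sub (hcont.norm.pow 2)).measurable)
      (fun x => by
        have h1 := hbound x
        have h2 : 0 ≤ ‖trigPoly T c x‖ ^ 2 := by positivity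
        rw [abs_le]
        constructor <;> nlinarith)
      (by
        rw [integral_sub (integrable_const _) hint2, hmean]
        simp)
      (by
        calc ∫ x, (A - ‖trigPoly T c x‖ ^ 2) ^ 2 ∂ν
            ≤ ∫ x, (A ^ 2 + (M * A - 2 * A) * ‖trigPoly T c x‖ ^ 2) ∂ν := by
              refine integral_mono_of_nonneg (ae_of_all _ fun x => sq_nonneg _)
                ((integrable_const _).add (hint2.const_mul _)) (ae_of_all _ fun x => ?_)
              have h1 := hbound x
              have h2 : 0 ≤ ‖trigPoly T c x‖ ^ 2 := by positivity
              -- With `p = ‖f x‖ ^ 2 ≤ M * A`, the term `p ^ 2` in `(A - p) ^ 2` is at most `M * A *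
              -- p`.
              simp only
              nlinarith
          _ = M * A ^ 2 - A ^ 2 := by
              rw [integral_add (integrable_const _) (hint2.const_mul _), integral_const_mul,
                hmean]
              simp
              ring
          _ ≤ M * A ^ 2 := by
              have := sq_nonneg A
              linarith)
      (by positivity) (by positivity)
      (by nlinarith [mul_pos hMr (pow_pos hA0 2)])
    -- The energy event has the better rate `1 / (16 * M)`.
    refine h.trans (Real.exp_le_exp.2 (neg_le_neg ?_))
    refine mul_le_mul_of_nonneg_left ?_ (Nat.cast_nonneg N)
    rw [div_le_div_iff₀ (by positivity) (by positivity)]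
    nlinarith [mul_pos hMr (pow_pos hA0 2)]
  have hEq : ∀ p ∈ (Γ \ T) ×ˢ axisDirections, μ.real (E p) ≤ q := by
    rintro ⟨j, w⟩ hp
    obtain ⟨hj, hw⟩ := Finset.mem_product.1 hp
    obtain ⟨hjΓ, hjT⟩ := Finset.mem_sdiff.1 hj
    have habs : ∀ x, |(w * (starRingEnd ℂ (trigPoly T c x) * expFun j x)).re| ≤
        ‖trigPoly T c x‖ := fun x => by
      refine (Complex.abs_re_le_norm _).trans_eq ?_
      rw [norm_mul, norm_mul, norm_expFun, mul_one, RCLike.norm_conj,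
        norm_of_mem_axisDirections hw, one_mul]
    have h := measureReal_sum_ge_le (V := A) (K := √(M * A)) (u := √(A / (8 * M))) hX hind hmap
      (g := fun x => (w * (starRingEnd ℂ (trigPoly T c x) * expFun j x)).re)
      (by
        exact (Complex.continuous_re.comp (continuous_const.mul
          ((Complex.continuous_conj.comp hcont).mul (continuous_expFun j)))).measurable)
      (fun x => (habs x).trans (Real.le_sqrt_of_sq_le (hbound x)))
      (by
        have h0 := integral_conj_trigPoly_mul_expFun hν hT c hc hjΓ
        have hre := integral_re (𝕜 := ℂ) (μ := ν)
          ((integrable_conj_trigPoly_mul_expFun (T := T) c j).const_mul w)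
        rw [integral_const_mul, h0, hc j hjT] at hre
        simpa using hre)
      (by
        rw [← hmean]
        refine integral_mono_of_nonneg (ae_of_all _ fun x => sq_nonneg _) hint2
          (ae_of_all _ fun x => ?_)
        exact sq_le_sq' (by have := (abs_le.1 (habs x)).1; linarith) (abs_le.1 (habs x)).2)
      hA0 (by positivity)
      (by
        rw [← Real.sqrt_mul (by positivity)]
        refine Real.sqrt_le_iff.2 ⟨by positivity, ?_⟩
        have : A / (8 * M) * (M * A) = A ^ 2 / 8 := by
          field_simp
        rw [this]
        nlinarith [sq_nonneg A])
    -- Here `u ^ 2 / (4 * V)` is exactly `1 / (32 * M)`: the correlations dictate the constant.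
    refine h.trans_eq ?_
    rw [hq, Real.sq_sqrt (by positivity)]
    congr 3
    field_simp
    norm_num
  set B : Set Ω := E₀ ∪ ⋃ p ∈ (Γ \ T) ×ˢ axisDirections, E p with hB
  have hXm : ∀ j, Measurable fun ω => trigPoly T c (X j ω) := fun j =>
    hcont.measurable.comp (hX j)
  have hBm : MeasurableSet B := by
    refine MeasurableSet.union ?_ (Finset.measurableSet_biUnion _ fun p _ => ?_)
    · refine measurableSet_le measurable_const (Finset.measurable_sum _ fun j _ => ?_)
      exact measurable_const.sub ((hXm j).norm.pow_const 2)
    · refine measurableSet_le measurable_const (Finset.measurable_sum _ fun j _ => ?_)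
      exact Complex.measurable_re.comp (measurable_const.mul
        ((Complex.continuous_conj.measurable.comp (hXm j)).mul
          ((continuous_expFun p.1).measurable.comp (hX j))))
  have hcard : (((Γ \ T) ×ˢ axisDirections).card : ℝ) ≤ 4 * Γ.card := by
    have h : ((Γ \ T) ×ˢ axisDirections).card ≤ Γ.card * 4 := by
      rw [Finset.card_product]
      exact Nat.mul_le_mul (Finset.card_le_card Finset.sdiff_subset) card_axisDirections_le
    have h' : (((Γ \ T) ×ˢ axisDirections).card : ℝ) ≤ Γ.card * 4 := by exact_mod_cast h
    linarith
  have hΓ1 : (1 : ℝ) ≤ Γ.card := by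
    exact_mod_cast hT0.trans_le (Finset.card_le_card hT)
  have hq0 : 0 < q := Real.exp_pos _
  have hqε : 8 * Γ.card * q ≤ ε := by
    have h8 : (0 : ℝ) < 8 * Γ.card / ε := by positivity
    have : q ≤ (8 * Γ.card / ε)⁻¹ := by
      rw [← Real.exp_log h8, ← Real.exp_neg]
      refine Real.exp_le_exp.2 (neg_le_neg ?_)
      rw [mul_one_div, le_div_iff₀ (by positivity)]
      linarith
    calc 8 * Γ.card * q ≤ 8 * Γ.card * (8 * Γ.card / ε)⁻¹ := by gcongr
      _ = ε := by field_simp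
  have hBε : μ.real B ≤ ε := by
    calc μ.real B ≤ μ.real E₀ + μ.real (⋃ p ∈ (Γ \ T) ×ˢ axisDirections, E p) :=
          measureReal_union_le _ _
      _ ≤ q + ∑ p ∈ (Γ \ T) ×ˢ axisDirections, μ.real (E p) :=
          add_le_add hE₀q (measureReal_biUnion_finset_le _ _)
      _ ≤ q + ((Γ \ T) ×ˢ axisDirections).card * q := by
          have := Finset.sum_le_card_nsmul _ _ _ hEq
          rw [nsmul_eq_mul] at this
          linarith
      -- Uses `1 ≤ Γ.card` to absorb the single energy event.
      _ ≤ 8 * Γ.card * q := by nlinarith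
      _ ≤ ε := hqε
  calc 1 - ε ≤ 1 - μ.real B := by linarith
    _ = μ.real Bᶜ := (probReal_compl_eq_one_sub hBm).symm
    _ ≤ _ := by
      refine measureReal_mono fun ω hω n k S r hn hrun => ?_
      simp only [hB, Set.mem_compl_iff, Set.mem_union, Set.mem_iUnion, not_or, not_exists] at hω
      refine mem_of_isOMPRun hT hM hM0 hA hA0 (fun j => X j ω) (not_le.1 hω.1)
        (fun j hj w hw => not_le.1 (hω.2 (j, w) (Finset.mem_product.2 ⟨hj, hw⟩))) hn hrun

end SparseTrig

theorem mainTheorem2 :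
    ∃ C : ℝ, 0 < C ∧ C ≤ 32.62 ∧
      ∀ (d N M : ℕ) (Γ T : Finset (Fin d → ℤ)) (c : (Fin d → ℤ) → ℂ) (ε : ℝ)
        (Ω : Type*) [MeasurableSpace Ω] (μ : Measure Ω) [IsProbabilityMeasure μ]
        (X : Fin N → Ω → Fin d → ℝ),
        T ⊆ Γ → T.card ≤ M → (∀ k, k ∉ T → c k = 0) → c ≠ 0 → 0 < ε →
        (SparseTrig.IsContinuousModel μ X ∨
          ∃ m : ℕ, 2 ≤ m ∧ SparseTrig.EmbedsMod m Γ ∧ SparseTrig.IsDiscreteModel μ m X) →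
        C * M * Real.log (8 * Γ.card / ε) ≤ N →
        1 - ε ≤ μ.real {ω | ∀ (n : ℕ) (k : ℕ → Fin d → ℤ) (S : ℕ → Finset (Fin d → ℤ))
          (r : ℕ → EuclideanSpace ℂ (Fin N)), 1 ≤ n →
          SparseTrig.IsOMPRun Γ (fun j => X j ω)
            (SparseTrig.sampleVec (SparseTrig.trigPoly Γ c) (fun j => X j ω)) n k S r →
          k 1 ∈ T} := by
  refine ⟨32, by norm_num, by norm_num, ?_⟩
  intro d N M Γ T c ε Ω _ μ _ X hT hM hc hc0 hε hmodel hN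
  rcases hmodel with h | ⟨m, hm, hΓ, h⟩
  · have := SparseTrig.isProbabilityMeasure_cube d
    exact SparseTrig.measureReal_forall_isOMPRun_ge (SparseTrig.isOrthonormalFor_cube Γ)
      h.measurable h.indep h.uniform hT hM hc hc0 hε hN
  · have hm0 : m ≠ 0 := by omega
    have := SparseTrig.isProbabilityMeasure_grid d hm0
    exact SparseTrig.measureReal_forall_isOMPRun_ge (SparseTrig.isOrthonormalFor_grid hm0 hΓ)
      h.measurable h.indep h.uniform hT hM hc hc0 hε hN
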